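/- Let $\mathbb T=\mathbb R/\mathbb Z$ with Lebesgue measure $dh$, let $\mathcal M(\mathbb T)$ be the space of finite signed Radon measures on $\mathbb T$, and let $\mathcal M^+(\mathbb T)$ be the set of its nonnegative elements. Let $$U=\Big\{u\in L^2(\mathbb T):\int_{\mathbb T}u\,dh=0\Big\},\qquad \widetilde V=\{u\in U:\ u\in W^{1,2}(\mathbb T),\ u_{hh}\in\mathcal M(\mathbb T)\},\qquad \|u\|_{\widetilde V}=\|u_{hh}\|_{\mathcal M(\mathbb T)},$$ where derivatives in $h$ are distributional and $U$ carries the inner product $\langle\cdot,\cdot\rangle$ of $L^2(\mathbb T)$. For $u\in\widetilde V$ let $u_{hh}=\eta_u+\nu_u$ be the Lebesgue decomposition, with $\eta_u\in L^1(\mathbb T)$ the absolutely continuous part and $\nu_u$ singular. Fix $c_0>0$ and $C\ge 2c_0$. Put $\Phi(x)=\frac12x^{-2}$ for $x>0$ and $\Phi(x)=+\infty$ for $x\le 0$, and for $u\in\widetilde V$ $$\phi(u)=\begin{cases}\int_{\mathbb T}\Phi(\eta_u+c_0)\,dh & \text{if } u_{hh}+c_0\in\mathcal M^+(\mathbb T),\\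 +\infty&\text{otherwise,}\end{cases}\qquad \psi(u)=\begin{cases}0&\text{if }\|u\|_{\widetilde V}\le C,\\+\infty&\text{otherwise.}\end{cases}$$ For $u\in\widetilde V$ let $Bu$ be the set of all $\xi\in U$ such that $(\phi+\psi)(v)\ge(\phi+\psi)(u)+\langle\xi,v-u\rangle$ for all $v\in\widetilde V$, and let $D(B)$ be the set of all $u\in\widetilde V$ with $Bu\neq\emptyset$. **Theorem 3.1.** Let $T>0$ and $w^0\in D(B)$. Let $w\in L^\infty(0,T;\widetilde V)\cap C^0([0,T];U)$ with $w_t\in L^\infty(0,T;U)$ be the variational inequality solution with initial datum $w^0$, that is, $w(0)=w^0$ and, for a.e. $t\in[0,T]$, $$\langle w_t(t),v-w(t)\rangle+(\phi+\psi)(v)-(\phi+\psi)(w(t))\ge0\qquad\text{for all }v\in\widetilde V.$$ Then $w$ is a strong solution. That is, with $\eta(t)=\eta_{w(t)}$: 1. for a.e. $t\in[0,T]$ one has $\eta(t)+c_0>0$ a.e. on $\mathbb T$, $(\eta(t)+c_0)^{-3}\in L^1(\mathbb T)$ and $((\eta(t)+c_0)^{-3})_{hh}\in U$, and $$w_t=\big((\eta+c_0)^{-3}\big)_{hh}\qquad\text{for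 a.e. }(t,h)\in[0,T]\times\mathbb T;$$ 2. $\big((\eta+c_0)^{-3}\big)_{hh}\in L^\infty(0,T;U)$; 3. with $E(t)=\frac12\int_{\mathbb T}\big[((\eta(t)+c_0)^{-3})_{hh}\big]^2\,dh$, where $\eta(0)=\eta_{w^0}$, one has $E(0)<\infty$ and $E(t)\le E(0)$ for a.e. $t\in[0,T]$. -/

import Mathlib

open MeasureTheory Set
open scoped ENNReal ContDiff InnerProductSpace

noncomputable section

namespace ThinFilm

/-- The torus `ℝ / ℤ` with Lebesgue measure `volume` (of total mass one). One-periodic functions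
and measures on the line are functions and measures on `𝕋`. -/
abbrev 𝕋 : Type := UnitAddCircle

/-- The space `U` of square integrable one-periodic functions with mean value zero, with the
norm and the inner product of `L²(𝕋)`. -/
def U : Submodule ℝ (Lp ℝ 2 (volume : Measure 𝕋)) where
  carrier := {f | ∫ h, f h = 0}
  add_mem' {f g} hf hg := by
    have hi (k : Lp ℝ 2 (volume : Measure 𝕋)) : Integrable k volume :=
      (Lp.memLp k).integrable (by norm_num)
    simp only [mem_ofPred_eq] at hf hg ⊢
    rw [integral_congr_ae (Lp.coeFn_add f g)]
    simp only [Pi.add_apply]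
    rw [integral_add (hi f) (hi g), hf, hg, add_zero]
  zero_mem' := by
    simp only [mem_ofPred_eq]
    rw [integral_congr_ae (Lp.coeFn_zero ℝ 2 volume)]
    simp
  smul_mem' c f hf := by
    simp only [mem_ofPred_eq] at hf ⊢
    rw [integral_congr_ae (Lp.coeFn_smul c f)]
    simp only [Pi.smul_apply, smul_eq_mul]
    rw [integral_const_mul, hf, mul_zero]

/-- `U` is complete, so that Bochner integrals of `U`-valued functions are meaningful. -/
instance : CompleteSpace U := by
  have hU : IsClosed (U : Set (Lp ℝ 2 (volume : Measure 𝕋))) := by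
    have he : (U : Set (Lp ℝ 2 (volume : Measure 𝕋))) =
        {f | ⟪indicatorConstLp 2 MeasurableSet.univ (measure_ne_top volume univ) (1 : ℝ), f⟫_ℝ
          = 0} := by
      ext f
      rw [mem_ofPred_eq, L2.inner_indicatorConstLp_one, setIntegral_univ]
      rfl
    rw [he]
    exact isClosed_eq (continuous_const.inner continuous_id) continuous_const
  exact hU.completeSpace_coe

/-! ### Smooth functions and distributional derivatives on the torus -/

/-- Smooth functions on the torus, the test functions. -/
def IsSmooth (f : 𝕋 → ℝ) : Prop := ContDiff ℝ ∞ fun x : ℝ => f (x : 𝕋)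

/-- The classical `n`-th derivative of a function on the torus. -/
def D (n : ℕ) (f : 𝕋 → ℝ) (h : 𝕋) : ℝ := iteratedDeriv n (fun x : ℝ => f (h + (x : 𝕋))) 0

/-- `u ∈ W^{1,2}(𝕋)`: the distributional derivative of `u` is a square integrable function. -/
def InW12 (u : U) : Prop :=
  ∃ g : Lp ℝ 2 (volume : Measure 𝕋), ∀ f : 𝕋 → ℝ, IsSmooth f →
    ∫ h, u.1 h * D 1 f h = -∫ h, g h * f h

/-- `u_hh = μ` in the sense of distributions on `𝕋`, with `μ` a finite signed (Radon) measure. -/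
def HasMeasureHH (u : U) (μ : SignedMeasure 𝕋) : Prop :=
  ∀ f : 𝕋 → ℝ, IsSmooth f → ∫ h, u.1 h * D 2 f h = ∫ᵛ h, f h ∂•μ

/-- `F_hh = g` in the sense of distributions on `𝕋`, for integrable `F` and square integrable
`g`. -/
def HasL2HH (F : 𝕋 → ℝ) (g : U) : Prop :=
  Integrable F volume ∧
    ∀ f : 𝕋 → ℝ, IsSmooth f → ∫ h, F h * D 2 f h = ∫ h, g.1 h * f h

/-! ### The space `Ṽ` and the functionals -/

/-- The space `Ṽ` of functions in `W^{1,2}` with mean value zero whose second distributional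
derivative is a finite signed measure. -/
def V : Set U := {u | InW12 u ∧ ∃ μ, HasMeasureHH u μ}

open Classical in
/-- The measure `u_hh`, for `u ∈ Ṽ` (it is unique; the value `0` outside `Ṽ` is not used). -/
def hh (u : U) : SignedMeasure 𝕋 := if H : ∃ μ, HasMeasureHH u μ then H.choose else 0

/-- The norm of `Ṽ`, the total mass of `u_hh`. -/
def normV (u : U) : ℝ≥0∞ := (hh u).totalVariation univ

/-- The density `η` of the part of `u_hh` that is absolutely continuous with respect to Lebesgue
measure (the Lebesgue decomposition is `u_hh = η + ν`, with `ν` singular). -/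
def eta (u : U) : 𝕋 → ℝ := (hh u).rnDeriv volume

/-- `Φ(x) = x⁻² / 2` for `x > 0`, and `+∞` for `x ≤ 0`. -/
def Phi (x : ℝ) : ℝ≥0∞ := if x ≤ 0 then ⊤ else ENNReal.ofReal ((x ^ 2)⁻¹ / 2)

open Classical in
/-- `φ(u) = ∫ Φ(η + c₀) dh` if `u ∈ Ṽ` and `u_hh + c₀ ∈ M⁺(𝕋)`, and `+∞` otherwise. -/
def phi (c₀ : ℝ) (u : U) : ℝ≥0∞ :=
  if u ∈ V ∧ 0 ≤ hh u + c₀ • (volume : Measure 𝕋).toSignedMeasure then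
    ∫⁻ h, Phi (eta u h + c₀)
  else ⊤

open Classical in
/-- The indicator functional `ψ` of the ball of radius `C` of `Ṽ`. -/
def psi (C : ℝ) (u : U) : ℝ≥0∞ := if u ∈ V ∧ normV u ≤ ENNReal.ofReal C then 0 else ⊤

/-- The functional `φ + ψ`, with values in `(-∞, +∞]`. -/
def total (c₀ C : ℝ) (u : U) : EReal := ((phi c₀ u + psi C u : ℝ≥0∞) : EReal)

/-- The operator `B`: the elements of the sub-differential of `φ + ψ` on `Ṽ` that lie in `U`
(acting on `Ṽ ⊆ U` through the inner product of `U`). -/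
def B (c₀ C : ℝ) (u : U) : Set U :=
  {ξ | u ∈ V ∧ ∀ v ∈ V, total c₀ C u + ((⟪ξ, v - u⟫_ℝ : ℝ) : EReal) ≤ total c₀ C v}

/-- The domain of `B`. -/
def domB (c₀ C : ℝ) : Set U := {u | (B c₀ C u).Nonempty}

/-! ### The two notions of solution -/

/-- Lebesgue measure on the time interval `[0, T]`. -/
def time (T : ℝ) : Measure ℝ := volume.restrict (Icc 0 T)

/-- `w ∈ L^∞(0,T;Ṽ) ∩ C⁰([0,T];U)` and `w_t = wt ∈ L^∞(0,T;U)`. The time derivative is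
characterised by the fundamental theorem of calculus, with a Bochner integral in `U`. The
measurability of `w` as a `Ṽ`-valued map is the weak-* one, which follows from the continuity
of `w` in `U`. -/
structure IsRegular (T : ℝ) (w wt : ℝ → U) : Prop where
  bounded : ∃ M : ℝ, ∀ᵐ t ∂time T, w t ∈ V ∧ normV (w t) ≤ ENNReal.ofReal M
  continuousOn : ContinuousOn w (Icc 0 T)
  deriv_memLp : MemLp wt ⊤ (time T)
  deriv_eq : ∀ t ∈ Icc 0 T, w t = w 0 + ∫ s in (0 : ℝ)..t, wt s

/-- `w`, with time derivative `wt`, is a variational inequality solution on `[0, T]`: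
`⟨w_t, v - w⟩ + (φ + ψ)(v) - (φ + ψ)(w) ≥ 0` for a.e. `t` and all `v ∈ Ṽ`. The last term stands on
the other side, so that no difference of infinities occurs. -/
structure IsVISolution (c₀ C T : ℝ) (w wt : ℝ → U) : Prop extends IsRegular T w wt where
  inequality : ∀ᵐ t ∂time T, ∀ v ∈ V,
    total c₀ C (w t) ≤ ((⟪wt t, v - w t⟫_ℝ : ℝ) : EReal) + total c₀ C v

/-- `g = ((η + c₀)⁻³)_hh`, where `η` is the absolutely continuous part of `u_hh`, `u ∈ Ṽ`. It is
required that `η + c₀` is positive almost everywhere, so that the power is meaningful. -/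
def IsFluxHH (c₀ : ℝ) (u : U) (g : U) : Prop :=
  u ∈ V ∧ (∀ᵐ h : 𝕋, 0 < eta u h + c₀) ∧ HasL2HH (fun h => ((eta u h + c₀) ^ 3)⁻¹) g

/-- The energy `E(u) = ½ ∫ [((η + c₀)⁻³)_hh]² dh`; it is `+∞` if `((η + c₀)⁻³)_hh` is not defined
as an element of `L²`. (There is at most one `g` to take the infimum over.) -/
def energy (c₀ : ℝ) (u : U) : ℝ≥0∞ :=
  ⨅ (g : U) (_ : IsFluxHH c₀ u g), ENNReal.ofReal (1 / 2 * ∫ h, g.1 h ^ 2)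

/-- `w`, with time derivative `wt`, is a strong solution on `[0, T]`. Here `F` is the function
`((η + c₀)⁻³)_hh` of time and space. -/
structure IsStrongSolution (c₀ T : ℝ) (w wt : ℝ → U) : Prop extends IsRegular T w wt where
  equation : ∃ F : ℝ → U, (∀ᵐ t ∂time T, IsFluxHH c₀ (w t) (F t)) ∧
    (∀ᵐ p ∂(time T).prod (volume : Measure 𝕋), (wt p.1).1 p.2 = (F p.1).1 p.2) ∧
    MemLp F ⊤ (time T)
  energy_zero_lt_top : energy c₀ (w 0) < ⊤
  dissipation : ∀ᵐ t ∂time T, energy c₀ (w t) ≤ energy c₀ (w 0)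

end ThinFilm

end

open ThinFilm

/-!
The operator `B` is a subdifferential, hence monotone. Comparing a solution of `w_t + B w ∋ 0` with
its own time translates gives `‖w(t + τ) - w(t)‖ ≤ ‖w(τ) - w(0)‖ ≤ τ ‖ξ‖` for every `ξ ∈ B (w(0))`,
so that `‖w_t‖ ≤ ‖ξ‖` almost everywhere.

It remains to see that `ξ ∈ B u` forces `-ξ = ((η + c₀)⁻³)_hh`. As `u_hh` has total mass zero, the
constraint `u_hh + c₀ ≥ 0` bounds the norm of `u` by `2 c₀ ≤ C`, so `ψ` is inactive. Directions `v`
whose second derivative is a bounded function supported where `η + c₀ ≥ δ` are therefore admissible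
with both signs. With `R` such that `R_hh = ξ`, the first variation in these directions is
`∫ v_hh (R + (η + c₀)⁻³) = 0`, and by the du Bois-Reymond lemma `R + (η + c₀)⁻³` is constant on
`{η + c₀ ≥ δ}`, for every `δ > 0`. No information is lost in the limit `δ → 0`, because
`φ(u) < ∞` makes `η + c₀` positive almost everywhere.
-/

namespace ThinFilm

section SignedMeasure

variable {X : Type*} [MeasurableSpace X]

theorem integral_toSignedMeasure_sub {p n : Measure X} [IsFiniteMeasure p] [IsFiniteMeasure n]
    {f : X → ℝ} (hp : Integrable f p) (hn : Integrable f n) :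
    ∫ᵛ x, f x ∂•(p.toSignedMeasure - n.toSignedMeasure) = ∫ x, f x ∂p - ∫ x, f x ∂n := by
  have vectorIntegrable {q : Measure X} [IsFiniteMeasure q] (hq : Integrable f q) :
      q.toSignedMeasure.Integrable f := by
    rwa [VectorMeasure.Integrable, Measure.variation_toSignedMeasure]
  have lsmul_eq_flip : (ContinuousLinearMap.lsmul ℝ ℝ : ℝ →L[ℝ] ℝ →L[ℝ] ℝ) =
      (ContinuousLinearMap.lsmul ℝ ℝ).flip := by
    ext; simp
  rw [VectorMeasure.integral_sub_vectorMeasure (vectorIntegrable hp) (vectorIntegrable hn),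
    lsmul_eq_flip, VectorMeasure.integral_toSignedMeasure, VectorMeasure.integral_toSignedMeasure]

theorem integral_eq_integral_posPart_sub_negPart (s : SignedMeasure X) {f : X → ℝ}
    (hf : Integrable f s.totalVariation) :
    ∫ᵛ x, f x ∂•s = ∫ x, f x ∂s.toJordanDecomposition.posPart -
      ∫ x, f x ∂s.toJordanDecomposition.negPart := by
  obtain ⟨hpos, hneg⟩ := integrable_add_measure.1 hf
  conv_lhs => rw [← s.toSignedMeasure_toJordanDecomposition]
  exact integral_toSignedMeasure_sub hpos hneg

theorem integral_add_signedMeasure {s t : SignedMeasure X} {f : X → ℝ}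
    (hs : Integrable f s.totalVariation) (ht : Integrable f t.totalVariation) :
    ∫ᵛ x, f x ∂•(s + t) = ∫ᵛ x, f x ∂•s + ∫ᵛ x, f x ∂•t := by
  rw [SignedMeasure.totalVariation_eq_variation] at hs ht
  exact VectorMeasure.integral_add_vectorMeasure hs ht

theorem integral_withDensityᵥ {μ : Measure X} {f g : X → ℝ} (hf : AEStronglyMeasurable f μ)
    (hg : Integrable g μ) (hgf : Integrable (fun x => g x * f x) μ) :
    ∫ᵛ x, f x ∂•μ.withDensityᵥ g = ∫ x, g x * f x ∂μ := by
  have := isFiniteMeasure_withDensity_ofReal hg.2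
  have := isFiniteMeasure_withDensity_ofReal hg.neg.2
  have integrable_max {k : X → ℝ} (hk : Integrable k μ)
      (hkf : Integrable (fun x => k x * f x) μ) : Integrable (fun x => max (k x) 0 * f x) μ := by
    refine hkf.mono (hk.pos_part.1.mul hf) (.of_forall fun x => ?_)
    rw [norm_mul, norm_mul, Real.norm_of_nonneg (le_max_right _ _)]
    exact mul_le_mul_of_nonneg_right (max_le (le_abs_self _) (abs_nonneg _)) (norm_nonneg _)
  have integrable_pos {k : X → ℝ} (hk : Integrable k μ)
      (hkf : Integrable (fun x => k x * f x) μ) :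
      Integrable f (μ.withDensity fun x => ENNReal.ofReal (k x)) := by
    rw [integrable_withDensity_iff_integrable_smul₀' hk.1.aemeasurable.ennreal_ofReal (by simp)]
    simpa only [ENNReal.toReal_ofReal', smul_eq_mul] using integrable_max hk hkf
  have integral_pos {k : X → ℝ} (hk : Integrable k μ) :
      ∫ x, f x ∂(μ.withDensity fun x => ENNReal.ofReal (k x)) = ∫ x, max (k x) 0 * f x ∂μ := by
    rw [integral_withDensity_eq_integral_toReal_smul₀ hk.1.aemeasurable.ennreal_ofReal (by simp)]
    simp only [ENNReal.toReal_ofReal', smul_eq_mul]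
  have hg' : Integrable (fun x => -g x) μ := hg.neg
  have hgf' : Integrable (fun x => -g x * f x) μ :=
    hgf.neg.congr (.of_forall fun x => (neg_mul _ _).symm)
  rw [withDensityᵥ_eq_withDensity_pos_part_sub_withDensity_neg_part hg,
    integral_toSignedMeasure_sub (integrable_pos hg hgf) (integrable_pos hg' hgf'),
    integral_pos hg, integral_pos hg', ← integral_sub (integrable_max hg hgf)
      (integrable_max hg' hgf')]
  refine integral_congr_ae (.of_forall fun x => ?_)
  beta_reduce
  rw [← sub_mul, max_zero_sub_eq_self]

open scoped BoundedContinuousFunction in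
theorem signedMeasure_ext_of_forall_mem_subalgebra [PseudoEMetricSpace X]
    [BorelSpace X] [CompleteSpace X] [SecondCountableTopology X] {A : StarSubalgebra ℝ (X →ᵇ ℝ)}
    (hA : (A.map (BoundedContinuousFunction.toContinuousMapStarₐ ℝ)).SeparatesPoints)
    {s t : SignedMeasure X} (h : ∀ f ∈ A, ∫ᵛ x, f x ∂•s = ∫ᵛ x, f x ∂•t) : s = t := by
  have cross_eq : s.toJordanDecomposition.posPart + t.toJordanDecomposition.negPart =
      t.toJordanDecomposition.posPart + s.toJordanDecomposition.negPart := by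
    refine ext_of_forall_mem_subalgebra_integral_eq_of_pseudoEMetric_complete_countable hA
      fun f hf => ?_
    rw [integral_add_measure (f.integrable _) (f.integrable _),
      integral_add_measure (f.integrable _) (f.integrable _)]
    have hst := h f hf
    rw [integral_eq_integral_posPart_sub_negPart s (f.integrable _),
      integral_eq_integral_posPart_sub_negPart t (f.integrable _)] at hst
    linarith
  ext i hi
  rw [s.apply_eq_posPart_real_sub_negPart_real hi, t.apply_eq_posPart_real_sub_negPart_real hi]
  have hreal := congrArg (fun q : Measure X => q.real i) cross_eq
  rw [measureReal_add_apply, measureReal_add_apply] at hreal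
  linarith

theorem singularPart_apply_nonneg {s t : SignedMeasure X} {μ : Measure X}
    [s.HaveLebesgueDecomposition μ] (ht : t ≪ᵥ μ.toENNRealVectorMeasure) (hst : 0 ≤ s + t)
    {i : Set X} (hi : MeasurableSet i) : 0 ≤ s.singularPart μ i := by
  obtain ⟨n, hn, hsing, hμ⟩ := s.mutuallySingular_singularPart μ
  have hin := hi.inter hn.compl
  have hs : s.singularPart μ i = s (i ∩ nᶜ) := by
    conv_rhs => rw [← s.singularPart_add_withDensity_rnDeriv_eq μ]
    conv_lhs => rw [← inter_union_compl i n]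
    rw [VectorMeasure.of_union (disjoint_compl_right.mono inter_subset_right inter_subset_right)
      (hi.inter hn) hin, hsing _ inter_subset_right, _root_.add_apply,
      Measure.withDensityᵥ_absolutelyContinuous _ _ (hμ _ inter_subset_right), zero_add, add_zero]
  have hle := VectorMeasure.le_iff.1 hst _ hin
  rwa [_root_.add_apply, ht (hμ _ inter_subset_right), add_zero, ← hs] at hle

theorem totalVariation_real_univ_le {s t : SignedMeasure X} (hs : s univ = 0) (ht : 0 ≤ t)
    (hst : 0 ≤ s + t) : s.totalVariation.real univ ≤ 2 * t univ := by
  set p := s.toJordanDecomposition.posPart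
  set n := s.toJordanDecomposition.negPart
  have hsub {i : Set X} (hi : MeasurableSet i) : s i = p.real i - n.real i :=
    s.apply_eq_posPart_real_sub_negPart_real hi
  obtain ⟨i, hi, hp, hn⟩ := s.toJordanDecomposition.mutuallySingular
  have hp_i : p.real i = 0 := by rw [measureReal_def, hp, ENNReal.toReal_zero]
  have hn_ic : n.real iᶜ = 0 := by rw [measureReal_def, hn, ENNReal.toReal_zero]
  have hn_le : n.real univ ≤ t univ := by
    calc n.real univ = -s i := by
          rw [← measureReal_add_measureReal_compl hi, hsub hi, hp_i, hn_ic]; ring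
      _ ≤ t i := neg_le_iff_add_nonneg'.2 (VectorMeasure.le_iff.1 hst i hi)
      _ ≤ t univ := by
          rw [← union_compl_self i, VectorMeasure.of_union disjoint_compl_right hi hi.compl]
          exact le_add_of_nonneg_right (VectorMeasure.le_iff.1 ht _ hi.compl)
  have hpn := hsub MeasurableSet.univ
  rw [SignedMeasure.totalVariation, measureReal_add_apply]
  linarith

end SignedMeasure

section Decomposition

variable {X : Type*} [MeasurableSpace X] {μ : Measure X} {s : SignedMeasure X} {g : X → ℝ}

theorem rnDeriv_add_withDensityᵥ [s.HaveLebesgueDecomposition μ] (hg : Integrable g μ) :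
    (s + μ.withDensityᵥ g).rnDeriv μ =ᵐ[μ] s.rnDeriv μ + g := by
  refine (SignedMeasure.eq_rnDeriv (s.singularPart μ) _ ((s.integrable_rnDeriv μ).add hg)
    (s.mutuallySingular_singularPart μ) ?_).symm
  rw [withDensityᵥ_add (s.integrable_rnDeriv μ) hg, ← add_assoc,
    s.singularPart_add_withDensity_rnDeriv_eq μ]

variable [IsFiniteMeasure μ] {c : ℝ}

theorem smul_toSignedMeasure_absolutelyContinuous :
    c • μ.toSignedMeasure ≪ᵥ μ.toENNRealVectorMeasure := by
  intro i hi
  by_cases hm : MeasurableSet i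
  · rw [Measure.toENNRealVectorMeasure_apply_measurable hm] at hi
    simp [hm, measureReal_def, hi]
  · exact VectorMeasure.not_measurable _ hm

theorem add_withDensityᵥ_add_smul_nonneg (hg : Integrable g μ)
    (hs : 0 ≤ s + c • μ.toSignedMeasure) (hsg : ∀ᵐ x ∂μ, 0 ≤ s.rnDeriv μ x + g x + c) :
    0 ≤ s + μ.withDensityᵥ g + c • μ.toSignedMeasure := by
  refine VectorMeasure.le_iff.2 fun i hi => ?_
  have hsing := singularPart_apply_nonneg smul_toSignedMeasure_absolutelyContinuous hs hi
  have habs : 0 ≤ ∫ x in i, (s.rnDeriv μ x + g x + c) ∂μ := setIntegral_nonneg_of_ae hsg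
  have hη := s.integrable_rnDeriv μ
  rw [integral_add (f := fun x => s.rnDeriv μ x + g x) (hη.add hg).integrableOn
    (integrable_const c).integrableOn, integral_add hη.integrableOn hg.integrableOn,
    setIntegral_const] at habs
  rw [← s.singularPart_add_withDensity_rnDeriv_eq μ]
  simp only [FunLike.coe_add, FunLike.coe_smul, FunLike.coe_zero, Pi.add_apply,
    Pi.smul_apply, Pi.zero_apply, withDensityᵥ_apply hη hi, withDensityᵥ_apply hg hi,
    Measure.toSignedMeasure_apply_measurable hi, smul_eq_mul] at habs ⊢
  linarith

end Decomposition

section DuBoisReymond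

variable {X : Type*} [MeasurableSpace X] {μ : Measure X} [IsFiniteMeasure μ]

theorem exists_ae_eq_const_of_forall_integral_mul_eq_zero {A : Set X} {P : X → ℝ} {K : ℝ}
    (hA : MeasurableSet A) (hP : Measurable P) (hK : ∀ x ∈ A, |P x| ≤ K)
    (h : ∀ (σ : X → ℝ) (L : ℝ), Measurable σ → (∀ x, |σ x| ≤ L) → (∀ x, σ x ≠ 0 → x ∈ A) →
      ∫ x, σ x ∂μ = 0 → ∫ x, σ x * P x ∂μ = 0) :
    ∃ m, ∀ᵐ x ∂μ, x ∈ A → P x = m := by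
  set m : ℝ := ⨍ x in A, P x ∂μ
  set σ : X → ℝ := A.indicator fun x => P x - m
  have σ_of_mem {x : X} (hx : x ∈ A) : σ x = P x - m := indicator_of_mem hx _
  have σ_of_notMem {x : X} (hx : x ∉ A) : σ x = 0 := indicator_of_notMem hx _
  have hσ : Measurable σ := (hP.sub_const m).indicator hA
  have hσ_le (x : X) : |σ x| ≤ |K| + |m| := by
    by_cases hx : x ∈ A
    · rw [σ_of_mem hx]
      exact (abs_sub _ _).trans (add_le_add_left ((hK x hx).trans (le_abs_self K)) _)
    · rw [σ_of_notMem hx, abs_zero]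
      positivity
  have hσ_int : Integrable σ μ := .of_bound hσ.aestronglyMeasurable _ (.of_forall hσ_le)
  have hσ_zero : ∫ x, σ x ∂μ = 0 := by
    rw [integral_indicator hA]
    exact integral_sub_average _ _
  have hσP := h σ _ hσ hσ_le (fun x => mem_of_indicator_ne_zero) hσ_zero
  have mul_eq (x : X) : σ x * P x = σ x ^ 2 + m * σ x := by
    by_cases hx : x ∈ A
    · rw [σ_of_mem hx]; ring
    · rw [σ_of_notMem hx]; ring
  have hσ_sq : Integrable (fun x => σ x ^ 2) μ := by
    refine .of_bound (hσ.pow_const 2).aestronglyMeasurable ((|K| + |m|) ^ 2)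
      (.of_forall fun x => ?_)
    rw [norm_pow]
    exact pow_le_pow_left₀ (norm_nonneg _) (hσ_le x) 2
  have integral_sq : ∫ x, σ x ^ 2 ∂μ = 0 := by
    simp_rw [mul_eq] at hσP
    rwa [integral_add hσ_sq (hσ_int.const_mul m), integral_const_mul, hσ_zero, mul_zero,
      add_zero] at hσP
  refine ⟨m, ?_⟩
  filter_upwards [(integral_eq_zero_iff_of_nonneg (fun x => sq_nonneg _) hσ_sq).1 integral_sq]
    with x hx hxA
  exact sub_eq_zero.1 ((σ_of_mem hxA).symm.trans (pow_eq_zero_iff two_ne_zero |>.1 hx))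

theorem exists_ae_eq_const_of_forall_le {μ : Measure X} {r P : X → ℝ} (hr : ∀ᵐ x ∂μ, 0 < r x)
    (h : ∀ δ > 0, ∃ m, ∀ᵐ x ∂μ, δ ≤ r x → P x = m) : ∃ m, ∀ᵐ x ∂μ, P x = m := by
  obtain rfl | hμ := eq_zero_or_neZero μ
  · simp only [ae_zero, Filter.eventually_bot, exists_const]
  choose m hm using fun n : ℕ => h (1 / ((n : ℝ) + 1)) Nat.one_div_pos_of_nat
  have hgood := hr.and (ae_all_iff.2 hm)
  obtain ⟨a, ha_pos, ha⟩ := hgood.exists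
  refine ⟨P a, ?_⟩
  filter_upwards [hgood] with x ⟨hx_pos, hx⟩
  obtain ⟨n, hn⟩ := exists_nat_one_div_lt (lt_min ha_pos hx_pos)
  rw [hx n (hn.le.trans (min_le_right _ _)), ha n (hn.le.trans (min_le_left _ _))]

end DuBoisReymond

section Phi

variable {X : Type*} [MeasurableSpace X] {μ : Measure X} {r : X → ℝ}

theorem Phi_of_pos {x : ℝ} (hx : 0 < x) : Phi x = ENNReal.ofReal ((x ^ 2)⁻¹ / 2) := by
  rw [Phi, if_neg hx.not_ge]

theorem measurable_Phi : Measurable Phi :=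
  Measurable.ite measurableSet_Iic measurable_const (by fun_prop)

theorem ae_pos_of_lintegral_Phi_lt_top (hr : Measurable r) (hfin : ∫⁻ x, Phi (r x) ∂μ < ⊤) :
    ∀ᵐ x ∂μ, 0 < r x := by
  filter_upwards [ae_lt_top (measurable_Phi.comp hr) hfin.ne] with x hx
  by_contra hn
  simp only [Function.comp_apply, Phi, if_pos (not_lt.1 hn), lt_self_iff_false] at hx

theorem lintegral_Phi_eq_lintegral_ofReal (hpos : ∀ᵐ x ∂μ, 0 < r x) :
    ∫⁻ x, Phi (r x) ∂μ = ∫⁻ x, ENNReal.ofReal ((r x ^ 2)⁻¹ / 2) ∂μ :=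
  lintegral_congr_ae (hpos.mono fun _ hx => Phi_of_pos hx)

theorem integrable_inv_sq_div_two (hr : Measurable r) (hfin : ∫⁻ x, Phi (r x) ∂μ < ⊤) :
    Integrable (fun x => (r x ^ 2)⁻¹ / 2) μ := by
  refine ⟨by fun_prop, ?_⟩
  rwa [hasFiniteIntegral_iff_ofReal (.of_forall fun x => by positivity),
    ← lintegral_Phi_eq_lintegral_ofReal (ae_pos_of_lintegral_Phi_lt_top hr hfin)]

theorem coe_lintegral_Phi_eq (hr : Measurable r) (hfin : ∫⁻ x, Phi (r x) ∂μ < ⊤) :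
    ((∫⁻ x, Phi (r x) ∂μ : ℝ≥0∞) : EReal) = ((∫ x, (r x ^ 2)⁻¹ / 2 ∂μ : ℝ) : EReal) := by
  rw [lintegral_Phi_eq_lintegral_ofReal (ae_pos_of_lintegral_Phi_lt_top hr hfin),
    ← ofReal_integral_eq_lintegral_ofReal (integrable_inv_sq_div_two hr hfin)
      (.of_forall fun x => by positivity), EReal.coe_ennreal_ofReal,
    max_eq_left (integral_nonneg fun x => by positivity)]

theorem coe_lintegral_Phi_le {J : X → ℝ} (hJ : Integrable J μ)
    (h : ∀ᵐ x ∂μ, 0 < r x ∧ (r x ^ 2)⁻¹ / 2 ≤ J x) :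
    ((∫⁻ x, Phi (r x) ∂μ : ℝ≥0∞) : EReal) ≤ ((∫ x, J x ∂μ : ℝ) : EReal) := by
  have hJ_nonneg : 0 ≤ᵐ[μ] J := h.mono fun x hx => le_trans (by positivity) hx.2
  rw [lintegral_Phi_eq_lintegral_ofReal (h.mono fun _ hx => hx.1),
    ← max_eq_left (integral_nonneg_of_ae hJ_nonneg), ← EReal.coe_ennreal_ofReal,
    EReal.coe_ennreal_le_coe_ennreal_iff, ofReal_integral_eq_lintegral_ofReal hJ hJ_nonneg]
  exact lintegral_mono_ae (h.mono fun _ hx => ENNReal.ofReal_le_ofReal hx.2)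

theorem inv_add_sq_div_two_le {δ x s : ℝ} (hδ : 0 < δ) (hx : δ ≤ x) (hs : |s| ≤ δ / 2) :
    ((x + s) ^ 2)⁻¹ / 2 ≤ (x ^ 2)⁻¹ / 2 - s * (x ^ 3)⁻¹ + 8 * s ^ 2 / δ ^ 4 := by
  obtain ⟨hs_ge, hs_le⟩ := abs_le.1 hs
  have hx_pos : 0 < x := hδ.trans_le hx
  have hxs_pos : 0 < x + s := by linarith
  have taylor : ((x + s) ^ 2)⁻¹ / 2 = (x ^ 2)⁻¹ / 2 - s * (x ^ 3)⁻¹ +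
      s ^ 2 * (3 * x + 2 * s) / (2 * x ^ 3 * (x + s) ^ 2) := by
    field_simp
    ring
  rw [taylor]
  refine add_le_add_right ?_ _
  calc s ^ 2 * (3 * x + 2 * s) / (2 * x ^ 3 * (x + s) ^ 2)
      ≤ s ^ 2 * (4 * x) / (2 * x ^ 3 * (x / 2) ^ 2) := by
        gcongr <;> linarith
    _ = 8 * s ^ 2 / x ^ 4 := by field_simp; ring
    _ ≤ 8 * s ^ 2 / δ ^ 4 := by gcongr

section Variation

variable [IsFiniteMeasure μ] {σ : X → ℝ} {δ K : ℝ}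

theorem integrable_mul_inv_cube (hr : Measurable r) (hσ : Measurable σ) (hδ : 0 < δ)
    (hK : ∀ x, |σ x| ≤ K) (hσr : ∀ x, σ x ≠ 0 → δ ≤ r x) :
    Integrable (fun x => σ x * (r x ^ 3)⁻¹) μ := by
  refine Integrable.of_bound (by fun_prop) (K * (δ ^ 3)⁻¹) (.of_forall fun x => ?_)
  have hK_nonneg : 0 ≤ K := (abs_nonneg _).trans (hK x)
  by_cases hx : σ x = 0
  · rw [hx, zero_mul, norm_zero]
    positivity
  · have hr_pos : 0 < r x := hδ.trans_le (hσr x hx)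
    rw [norm_mul, Real.norm_eq_abs, Real.norm_of_nonneg (by positivity)]
    gcongr
    exacts [hK x, hσr x hx]

theorem add_pos_and_inv_add_sq_le {x s : ℝ} (hδ : 0 < δ) (hx : 0 < x) (hsx : s ≠ 0 → δ ≤ x)
    (hs : |s| ≤ δ / 2) :
    0 < x + s ∧
      ((x + s) ^ 2)⁻¹ / 2 ≤ (x ^ 2)⁻¹ / 2 - s * (x ^ 3)⁻¹ + 8 * s ^ 2 / δ ^ 4 := by
  by_cases h : s = 0
  · subst h
    simpa using hx
  · exact ⟨by linarith [hsx h, neg_le_of_abs_le hs], inv_add_sq_div_two_le hδ (hsx h) hs⟩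

theorem coe_lintegral_Phi_add_le (hr : Measurable r) (hfin : ∫⁻ x, Phi (r x) ∂μ < ⊤)
    (hσ : Measurable σ) (hδ : 0 < δ) (hK : ∀ x, |σ x| ≤ K) (hσr : ∀ x, σ x ≠ 0 → δ ≤ r x)
    {ε : ℝ} (hε : ∀ x, |ε * σ x| ≤ δ / 2) :
    ((∫⁻ x, Phi (r x + ε * σ x) ∂μ : ℝ≥0∞) : EReal) ≤
      ((∫ x, (r x ^ 2)⁻¹ / 2 ∂μ - ε * ∫ x, σ x * (r x ^ 3)⁻¹ ∂μ +
        (∫ x, 8 * σ x ^ 2 / δ ^ 4 ∂μ) * ε ^ 2 : ℝ) : EReal) := by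
  have hint : Integrable (fun x => (r x ^ 2)⁻¹ / 2 - ε * (σ x * (r x ^ 3)⁻¹)) μ :=
    (integrable_inv_sq_div_two hr hfin).sub
      ((integrable_mul_inv_cube hr hσ hδ hK hσr).const_mul ε)
  have hint_sq : Integrable (fun x => 8 * σ x ^ 2 / δ ^ 4) μ := by
    refine Integrable.of_bound (by fun_prop) (8 * K ^ 2 / δ ^ 4) (.of_forall fun x => ?_)
    rw [Real.norm_of_nonneg (by positivity), ← sq_abs]
    gcongr
    exact hK x
  rw [← integral_const_mul, ← integral_sub (integrable_inv_sq_div_two hr hfin)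
    ((integrable_mul_inv_cube hr hσ hδ hK hσr).const_mul ε), ← integral_mul_const,
    ← integral_add hint (hint_sq.mul_const _)]
  refine coe_lintegral_Phi_le (hint.add (hint_sq.mul_const _)) ?_
  filter_upwards [ae_pos_of_lintegral_Phi_lt_top hr hfin] with x hx
  obtain ⟨hpos, hle⟩ := add_pos_and_inv_add_sq_le hδ hx
    (fun h => hσr x (right_ne_zero_of_mul h)) (hε x)
  exact ⟨hpos, hle.trans_eq (by ring)⟩

end Variation

theorem eq_zero_of_eventually_mul_le_sq {a L : ℝ}
    (h : ∀ᶠ ε in nhds (0 : ℝ), ε * a ≤ L * ε ^ 2) : a = 0 := by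
  have hmin : IsLocalMin (fun ε : ℝ => L * ε ^ 2 - ε * a) 0 := by
    filter_upwards [h] with ε hε
    linarith
  have hderiv : HasDerivAt (fun ε : ℝ => L * ε ^ 2 - ε * a) (-a) 0 := by
    simpa using
      ((hasDerivAt_pow 2 (0 : ℝ)).const_mul L).fun_sub ((hasDerivAt_id' (0 : ℝ)).mul_const a)
  exact neg_eq_zero.1 (hmin.hasDerivAt_eq_zero hderiv)

end Phi

section Smooth

variable {f : 𝕋 → ℝ}

theorem continuous_comp_coe_iff : Continuous (fun x : ℝ => f (x : 𝕋)) ↔ Continuous f :=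
  (QuotientAddGroup.isQuotientMap_mk _).continuous_iff.symm

theorem IsSmooth.continuous (hf : IsSmooth f) : Continuous f :=
  continuous_comp_coe_iff.1 (ContDiff.continuous hf)

theorem isSmooth_const (c : ℝ) : IsSmooth fun _ => c := contDiff_const

/-- The test functions as an algebra, to which the Stone–Weierstrass theorem applies. -/
def smoothFunctions : StarSubalgebra ℝ (BoundedContinuousFunction 𝕋 ℝ) where
  carrier := {f | IsSmooth f}
  mul_mem' hf hg := ContDiff.mul (𝕜 := ℝ) (n := ∞) hf hg
  add_mem' hf hg := ContDiff.add (𝕜 := ℝ) (n := ∞) hf hg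
  algebraMap_mem' c := isSmooth_const c
  star_mem' hf := hf

theorem fourier_one_coe (x : ℝ) :
    fourier (T := 1) 1 (x : 𝕋) = Complex.exp (((2 * Real.pi * x : ℝ) : ℂ) * Complex.I) := by
  rw [fourier_coe_apply]
  congr 1
  push_cast
  ring

theorem isSmooth_re_fourier_one : IsSmooth fun x => (fourier (T := 1) 1 x).re := by
  simp only [IsSmooth, fourier_one_coe, Complex.exp_ofReal_mul_I_re]
  fun_prop

theorem isSmooth_im_fourier_one : IsSmooth fun x => (fourier (T := 1) 1 x).im := by
  simp only [IsSmooth, fourier_one_coe, Complex.exp_ofReal_mul_I_im]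
  fun_prop

theorem exists_isSmooth_ne {x y : 𝕋} (hxy : x ≠ y) : ∃ f, IsSmooth f ∧ f x ≠ f y := by
  by_contra! h
  have hfourier : fourier (T := 1) 1 x = fourier 1 y :=
    Complex.ext (h _ isSmooth_re_fourier_one) (h _ isSmooth_im_fourier_one)
  rw [fourier_one, fourier_one] at hfourier
  exact hxy (AddCircle.injective_toCircle one_ne_zero (Circle.ext hfourier))

theorem separatesPoints_smoothFunctions :
    (smoothFunctions.map (BoundedContinuousFunction.toContinuousMapStarₐ ℝ)).SeparatesPoints := by
  intro x y hxy
  obtain ⟨f, hf, hne⟩ := exists_isSmooth_ne hxy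
  exact ⟨f, ⟨_, ⟨.mkOfCompact ⟨f, hf.continuous⟩, hf, rfl⟩, rfl⟩, hne⟩

theorem signedMeasure_ext_of_isSmooth {μ ν : SignedMeasure 𝕋}
    (h : ∀ f : 𝕋 → ℝ, IsSmooth f → ∫ᵛ x, f x ∂•μ = ∫ᵛ x, f x ∂•ν) : μ = ν :=
  signedMeasure_ext_of_forall_mem_subalgebra separatesPoints_smoothFunctions fun f hf => h f hf

theorem D_coe (n : ℕ) (f : 𝕋 → ℝ) (x : ℝ) :
    D n f (x : 𝕋) = iteratedDeriv n (fun y : ℝ => f (y : 𝕋)) x := by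
  simpa [D] using congrFun (iteratedDeriv_comp_const_add n (fun y : ℝ => f (y : 𝕋)) x) 0

theorem IsSmooth.D (hf : IsSmooth f) (n : ℕ) : IsSmooth (ThinFilm.D n f) := by
  simp only [IsSmooth, D_coe, iteratedDeriv_eq_iterate]
  exact ContDiff.iterate_deriv n hf

theorem D_two (f : 𝕋 → ℝ) : D 2 f = D 1 (D 1 f) := by
  ext x
  obtain ⟨x, rfl⟩ := QuotientAddGroup.mk_surjective x
  simp only [D_coe, iteratedDeriv_succ, iteratedDeriv_zero]

theorem D_const {n : ℕ} (hn : n ≠ 0) (c : ℝ) : D n (fun _ => c) = 0 := by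
  ext x
  simp only [D, iteratedDeriv_const, hn, if_false, Pi.zero_apply]

end Smooth

section Integration

variable {f g : 𝕋 → ℝ}

theorem integrable_of_continuous (hf : Continuous f) (μ : Measure 𝕋) [IsFiniteMeasure μ] :
    Integrable f μ :=
  hf.integrable_of_hasCompactSupport (.of_compactSpace f)

theorem integrable_mul_of_continuous (hg : Integrable g) (hf : Continuous f) :
    Integrable fun x => g x * f x :=
  integrableOn_univ.1 (hg.integrableOn.mul_continuousOn hf.continuousOn isCompact_univ)

theorem integral_mul_congr {k : 𝕋 → ℝ} (h : g =ᵐ[volume] k) (f : 𝕋 → ℝ) :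
    ∫ x, g x * f x = ∫ x, k x * f x :=
  integral_congr_ae (h.mono fun x hx => by simp only [hx])

theorem integral_withDensityᵥ_of_continuous (hf : Continuous f) (hg : Integrable g) :
    ∫ᵛ x, f x ∂•(volume : Measure 𝕋).withDensityᵥ g = ∫ x, g x * f x :=
  integral_withDensityᵥ hf.aestronglyMeasurable hg (integrable_mul_of_continuous hg hf)

theorem integrable_coe (f : Lp ℝ 2 (volume : Measure 𝕋)) : Integrable f :=
  (Lp.memLp f).integrable one_le_two

theorem inner_eq_integral (u v : U) : ⟪u, v⟫_ℝ = ∫ x, u.1 x * v.1 x := by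
  simp only [Submodule.coe_inner, L2.inner_def, RCLike.inner_apply, conj_trivial, mul_comm]

theorem exists_coe_ae_eq (hf : MemLp f 2) (hf_zero : ∫ x, f x = 0) : ∃ u : U, u.1 =ᵐ[volume] f :=
  ⟨⟨hf.toLp f, (integral_congr_ae hf.coeFn_toLp).trans hf_zero⟩, hf.coeFn_toLp⟩

theorem integral_coe_add_mul (u v : Lp ℝ 2 (volume : Measure 𝕋)) (hf : Continuous f) :
    ∫ x, (u + v) x * f x = (∫ x, u x * f x) + ∫ x, v x * f x := by
  rw [integral_mul_congr (Lp.coeFn_add u v), ← integral_add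
    (integrable_mul_of_continuous (integrable_coe u) hf)
    (integrable_mul_of_continuous (integrable_coe v) hf)]
  simp only [Pi.add_apply, add_mul]

end Integration

section WeakDerivatives

variable {u v : U}

theorem HasMeasureHH.unique {μ ν : SignedMeasure 𝕋} (hμ : HasMeasureHH u μ)
    (hν : HasMeasureHH u ν) : μ = ν :=
  signedMeasure_ext_of_isSmooth fun f hf => (hμ f hf).symm.trans (hν f hf)

theorem HasMeasureHH.hh_eq {μ : SignedMeasure 𝕋} (hμ : HasMeasureHH u μ) : hh u = μ := by
  have hex : ∃ μ, HasMeasureHH u μ := ⟨μ, hμ⟩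
  rw [hh, dif_pos hex]
  exact hex.choose_spec.unique hμ

theorem hasMeasureHH_hh (hu : u ∈ V) : HasMeasureHH u (hh u) := by
  obtain ⟨μ, hμ⟩ := hu.2
  rwa [hμ.hh_eq]

theorem hh_univ (hu : u ∈ V) : hh u univ = 0 := by
  have h := hasMeasureHH_hh hu _ (isSmooth_const 1)
  rw [D_const two_ne_zero, integral_eq_integral_posPart_sub_negPart _ (integrable_const 1)] at h
  rw [SignedMeasure.apply_eq_posPart_real_sub_negPart_real _ MeasurableSet.univ]
  simpa using h.symm

theorem HasMeasureHH.add {μ ν : SignedMeasure 𝕋} (hμ : HasMeasureHH u μ)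
    (hν : HasMeasureHH v ν) : HasMeasureHH (u + v) (μ + ν) := fun f hf => by
  rw [integral_add_signedMeasure (integrable_of_continuous hf.continuous _)
    (integrable_of_continuous hf.continuous _), ← hμ f hf, ← hν f hf]
  exact integral_coe_add_mul u.1 v.1 (hf.D 2).continuous

theorem InW12.add (hu : InW12 u) (hv : InW12 v) : InW12 (u + v) := by
  obtain ⟨a, ha⟩ := hu
  obtain ⟨b, hb⟩ := hv
  refine ⟨a + b, fun f hf => ?_⟩
  rw [integral_coe_add_mul a b hf.continuous, neg_add, ← ha f hf, ← hb f hf]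
  exact integral_coe_add_mul u.1 v.1 (hf.D 1).continuous

theorem HasL2HH.unique {F : 𝕋 → ℝ} {g k : U} (hg : HasL2HH F g) (hk : HasL2HH F k) : g = k := by
  have heq : volume.withDensityᵥ g.1 = volume.withDensityᵥ (k.1 : 𝕋 → ℝ) := by
    refine signedMeasure_ext_of_isSmooth fun f hf => ?_
    rw [integral_withDensityᵥ_of_continuous hf.continuous (integrable_coe g.1),
      integral_withDensityᵥ_of_continuous hf.continuous (integrable_coe k.1), ← hg.2 f hf,
      ← hk.2 f hf]
  exact Subtype.ext
    (Lp.ext ((integrable_coe g.1).ae_eq_of_withDensityᵥ_eq (integrable_coe k.1) heq))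

end WeakDerivatives

section Primitive

variable {g : 𝕋 → ℝ}

/-- `G` is a primitive of the integrable function `g` on the torus, that is, the absolutely
continuous solution of `G_h = g`. -/
structure IsPrimitive (G g : 𝕋 → ℝ) : Prop where
  integrable : Integrable g
  eq_add_integral : ∀ x : ℝ, G (x : 𝕋) = G 0 + ∫ y in (0 : ℝ)..x, g (y : 𝕋)

theorem intervalIntegrable_comp_coe (hg : Integrable g) (a b : ℝ) :
    IntervalIntegrable (fun y : ℝ => g (y : 𝕋)) volume a b := by
  have hper : Function.Periodic (fun y : ℝ => g (y : 𝕋)) 1 := fun y => by simp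
  refine hper.intervalIntegrable₀ one_ne_zero ?_ a b
  rw [intervalIntegrable_iff_integrableOn_Ioc_of_le zero_le_one]
  have hcomp := (UnitAddCircle.measurePreserving_mk 0).integrable_comp_of_integrable hg
  rwa [zero_add] at hcomp

theorem integral_eq_intervalIntegral (g : 𝕋 → ℝ) : ∫ x, g x = ∫ y in (0 : ℝ)..1, g (y : 𝕋) := by
  rw [← UnitAddCircle.intervalIntegral_preimage 0, zero_add]

namespace IsPrimitive

variable {G K k : 𝕋 → ℝ}

theorem continuous (hG : IsPrimitive G g) : Continuous G := by
  rw [← continuous_comp_coe_iff, funext hG.eq_add_integral]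
  exact continuous_const.add
    (intervalIntegral.continuous_primitive (intervalIntegrable_comp_coe hG.integrable) 0)

theorem integral_eq_zero (hG : IsPrimitive G g) : ∫ x, g x = 0 := by
  have hG_one := hG.eq_add_integral 1
  rw [AddCircle.coe_period, left_eq_add] at hG_one
  rwa [integral_eq_intervalIntegral]

theorem const_mul (hG : IsPrimitive G g) (c : ℝ) :
    IsPrimitive (fun x => c * G x) fun x => c * g x where
  integrable := hG.integrable.const_mul c
  eq_add_integral x := by
    rw [hG.eq_add_integral x, intervalIntegral.integral_const_mul, mul_add]

theorem absolutelyContinuous (hG : IsPrimitive G g) :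
    AbsolutelyContinuousOnInterval (fun x : ℝ => G (x : 𝕋)) 0 1 := by
  rw [funext hG.eq_add_integral]
  exact (LipschitzWith.const (G 0)).lipschitzOnWith.absolutelyContinuousOnInterval.fun_add
    ((intervalIntegrable_comp_coe hG.integrable 0 1)
      |>.absolutelyContinuousOnInterval_intervalIntegral (by simp))

theorem ae_deriv_eq (hG : IsPrimitive G g) :
    ∀ᵐ x : ℝ, x ∈ uIcc (0 : ℝ) 1 → deriv (fun x : ℝ => G (x : 𝕋)) x = g (x : 𝕋) := by
  filter_upwards [(intervalIntegrable_comp_coe hG.integrable 0 1).ae_hasDerivAt_integral]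
    with x hderiv hx
  rw [funext hG.eq_add_integral]
  exact ((hderiv hx 0 (by simp)).const_add _).deriv

theorem integral_mul_eq_integral_mul_deriv (hK : IsPrimitive K k) (G : 𝕋 → ℝ) :
    ∫ x, G x * k x = ∫ y in (0 : ℝ)..1, G (y : 𝕋) * deriv (fun x : ℝ => K (x : 𝕋)) y := by
  rw [integral_eq_intervalIntegral]
  refine intervalIntegral.integral_congr_ae ?_
  filter_upwards [hK.ae_deriv_eq] with y hderiv hy
  rw [hderiv (uIoc_subset_uIcc hy)]

theorem integral_mul (hG : IsPrimitive G g) (hK : IsPrimitive K k) :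
    ∫ x, G x * k x = -∫ x, g x * K x := by
  simp_rw [mul_comm (g _)]
  rw [hK.integral_mul_eq_integral_mul_deriv, hG.integral_mul_eq_integral_mul_deriv,
    hG.absolutelyContinuous.integral_mul_deriv_eq_deriv_mul hK.absolutelyContinuous,
    AddCircle.coe_period, AddCircle.coe_zero]
  simp only [mul_comm, sub_self, zero_sub]

end IsPrimitive

theorem exists_isPrimitive (hg : Integrable g) (hg_zero : ∫ x, g x = 0) :
    ∃ G, IsPrimitive G g ∧ ∫ x, G x = 0 := by
  set P : ℝ → ℝ := fun x => ∫ y in (0 : ℝ)..x, g (y : 𝕋) with hP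
  have hper : Function.Periodic P 1 := fun x => by
    have hg_per : Function.Periodic (fun y : ℝ => g (y : 𝕋)) 1 := fun y => by simp
    simp only [hP]
    rw [hg_per.intervalIntegral_add_eq_add 0 x fun a b => intervalIntegrable_comp_coe hg a b,
      zero_add, ← integral_eq_intervalIntegral, hg_zero, add_zero]
  have hprim (c : ℝ) : IsPrimitive (fun x => hper.lift x - c) g := by
    refine ⟨hg, fun x => ?_⟩
    have hlift_zero : hper.lift 0 = 0 := intervalIntegral.integral_same
    rw [hlift_zero, hper.lift_coe]
    ring
  refine ⟨_, hprim (∫ x, hper.lift x), ?_⟩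
  have hlift : Continuous hper.lift := by simpa using (hprim 0).continuous
  rw [integral_sub (integrable_of_continuous hlift _) (integrable_const _), integral_const,
    measureReal_def, UnitAddCircle.measure_univ, ENNReal.toReal_one, one_smul, sub_self]

theorem IsSmooth.isPrimitive {f : 𝕋 → ℝ} (hf : IsSmooth f) : IsPrimitive f (ThinFilm.D 1 f) := by
  refine ⟨integrable_of_continuous (hf.D 1).continuous _, fun x => ?_⟩
  simp only [D_coe, iteratedDeriv_one]
  rw [intervalIntegral.integral_deriv_eq_sub
    (fun y _ => (ContDiff.differentiable hf (by simp)).differentiableAt)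
    ((ContDiff.continuous_deriv hf (by simp)).intervalIntegrable _ _)]
  simp

end Primitive

section Potential

variable {v w : U} {S R g k : 𝕋 → ℝ}

/-- `v` solves `v_hh = g` for an integrable function `g`, and `S` is its continuous
representative. The primitive of `g` through which `v` is obtained is `v_h`. -/
structure IsPotential (v : U) (S g : 𝕋 → ℝ) : Prop where
  ae_eq : v.1 =ᵐ[volume] S
  exists_isPrimitive : ∃ G, IsPrimitive S G ∧ IsPrimitive G g

theorem exists_isPotential (hg : Integrable g) (hg_zero : ∫ x, g x = 0) :
    ∃ v S, IsPotential v S g := by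
  obtain ⟨G, hG, hG_zero⟩ := exists_isPrimitive hg hg_zero
  obtain ⟨S, hS, hS_zero⟩ := exists_isPrimitive (integrable_of_continuous hG.continuous _) hG_zero
  obtain ⟨v, hv⟩ := exists_coe_ae_eq
    (hS.continuous.memLp_of_hasCompactSupport (.of_compactSpace S)) hS_zero
  exact ⟨v, S, hv, G, hS, hG⟩

namespace IsPotential

theorem zero : IsPotential 0 0 0 where
  ae_eq := Lp.coeFn_zero ℝ 2 volume
  exists_isPrimitive := by
    have hzero : IsPrimitive 0 0 := ⟨integrable_zero _ _ _, fun x => by simp⟩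
    exact ⟨0, hzero, hzero⟩

theorem smul (hv : IsPotential v S g) (c : ℝ) :
    IsPotential (c • v) (fun x => c * S x) fun x => c * g x := by
  obtain ⟨G, hS, hG⟩ := hv.exists_isPrimitive
  refine ⟨?_, _, hS.const_mul c, hG.const_mul c⟩
  filter_upwards [Lp.coeFn_smul c v.1, hv.ae_eq] with x hcv hvS
  rw [Submodule.coe_smul, hcv, Pi.smul_apply, hvS, smul_eq_mul]

theorem continuous (hv : IsPotential v S g) : Continuous S :=
  let ⟨_, hS, _⟩ := hv.exists_isPrimitive
  hS.continuous

theorem integrable (hv : IsPotential v S g) : Integrable g :=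
  let ⟨_, _, hG⟩ := hv.exists_isPrimitive
  hG.integrable

theorem integral_mul_D (hv : IsPotential v S g) {f : 𝕋 → ℝ} (hf : IsSmooth f) :
    ∫ x, S x * D 2 f x = ∫ x, g x * f x := by
  obtain ⟨G, hS, hG⟩ := hv.exists_isPrimitive
  rw [D_two, hS.integral_mul (hf.D 1).isPrimitive, hG.integral_mul hf.isPrimitive, neg_neg]

theorem integral_mul (hv : IsPotential v S g) (hw : IsPotential w R k) :
    ∫ x, S x * k x = ∫ x, g x * R x := by
  obtain ⟨G, hS, hG⟩ := hv.exists_isPrimitive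
  obtain ⟨K, hR, hK⟩ := hw.exists_isPrimitive
  rw [hS.integral_mul hK, hG.integral_mul hR, neg_neg]

theorem inW12 (hv : IsPotential v S g) : InW12 v := by
  obtain ⟨G, hS, hG⟩ := hv.exists_isPrimitive
  have hG_memLp : MemLp G 2 :=
    hG.continuous.memLp_of_hasCompactSupport (.of_compactSpace G)
  refine ⟨hG_memLp.toLp G, fun f hf => ?_⟩
  rw [integral_mul_congr hv.ae_eq, integral_mul_congr hG_memLp.coeFn_toLp]
  exact hS.integral_mul hf.isPrimitive

theorem hasMeasureHH (hv : IsPotential v S g) :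
    HasMeasureHH v ((volume : Measure 𝕋).withDensityᵥ g) := fun f hf => by
  rw [integral_withDensityᵥ_of_continuous hf.continuous hv.integrable, integral_mul_congr hv.ae_eq]
  exact hv.integral_mul_D hf

theorem hasL2HH_const_sub {ξ : U} (hv : IsPotential v S ξ.1) {F : 𝕋 → ℝ} {c : ℝ}
    (hF : ∀ᵐ x, F x = c - S x) : HasL2HH F (-ξ) := by
  refine ⟨(integrable_of_continuous (continuous_const.sub hv.continuous) volume).congr
    (hF.mono fun x hx => hx.symm), fun f hf => ?_⟩
  have hD := (hf.D 2).continuous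
  have hD_zero : ∫ x, D 2 f x = 0 := by
    rw [D_two]
    exact (hf.D 1).isPrimitive.integral_eq_zero
  rw [integral_mul_congr hF, Submodule.coe_neg, integral_mul_congr (Lp.coeFn_neg ξ.1)]
  simp only [sub_mul, Pi.neg_apply, neg_mul]
  rw [integral_sub (f := fun x => c * D 2 f x) (g := fun x => S x * D 2 f x)
    (integrable_of_continuous (continuous_const.mul hD) volume)
    (integrable_of_continuous (hv.continuous.mul hD) volume), integral_const_mul, hD_zero,
    mul_zero, zero_sub, hv.integral_mul_D hf, integral_neg]

theorem mem_V (hv : IsPotential v S g) : v ∈ V := ⟨hv.inW12, _, hv.hasMeasureHH⟩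

end IsPotential

end Potential

section Perturbation

variable {c₀ C : ℝ} {u v ξ : U} {S g : 𝕋 → ℝ}

theorem measurable_eta (u : U) : Measurable (eta u) := SignedMeasure.measurable_rnDeriv _ _

theorem hh_add_potential (hu : u ∈ V) (hv : IsPotential v S g) :
    hh (u + v) = hh u + volume.withDensityᵥ g :=
  ((hasMeasureHH_hh hu).add hv.hasMeasureHH).hh_eq

theorem eta_add_potential (hu : u ∈ V) (hv : IsPotential v S g) :
    eta (u + v) =ᵐ[volume] eta u + g := by
  rw [eta, hh_add_potential hu hv]
  exact rnDeriv_add_withDensityᵥ hv.integrable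

/-- The constraint `u_hh + c₀ ∈ M⁺(𝕋)` in the definition of `φ`. -/
def Admissible (c₀ : ℝ) (u : U) : Prop :=
  u ∈ V ∧ 0 ≤ hh u + c₀ • (volume : Measure 𝕋).toSignedMeasure

theorem Admissible.add_potential (hu : Admissible c₀ u) (hv : IsPotential v S g)
    (hg : ∀ᵐ h, 0 ≤ eta u h + g h + c₀) : Admissible c₀ (u + v) := by
  refine ⟨⟨hu.1.1.add hv.inW12, _, (hasMeasureHH_hh hu.1).add hv.hasMeasureHH⟩, ?_⟩
  rw [hh_add_potential hu.1 hv]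
  exact add_withDensityᵥ_add_smul_nonneg hv.integrable hu.2 hg

theorem smul_toSignedMeasure_nonneg (hc₀ : 0 ≤ c₀) :
    0 ≤ c₀ • (volume : Measure 𝕋).toSignedMeasure :=
  VectorMeasure.le_iff.2 fun i hi => by
    rw [_root_.smul_apply, Measure.toSignedMeasure_apply_measurable hi, smul_eq_mul]
    exact mul_nonneg hc₀ measureReal_nonneg

theorem Admissible.normV_le (hc₀ : 0 ≤ c₀) (hu : Admissible c₀ u) :
    normV u ≤ ENNReal.ofReal (2 * c₀) := by
  have hle := totalVariation_real_univ_le (hh_univ hu.1) (smul_toSignedMeasure_nonneg hc₀) hu.2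
  rw [_root_.smul_apply, Measure.toSignedMeasure_apply_measurable MeasurableSet.univ,
    measureReal_def volume, UnitAddCircle.measure_univ, ENNReal.toReal_one, smul_eq_mul,
    mul_one] at hle
  rw [normV, ← ofReal_measureReal]
  exact ENNReal.ofReal_le_ofReal hle

theorem Admissible.total_eq (hc₀ : 0 ≤ c₀) (hC : 2 * c₀ ≤ C) (hu : Admissible c₀ u) :
    total c₀ C u = ((∫⁻ h, Phi (eta u h + c₀) : ℝ≥0∞) : EReal) := by
  rw [total, phi, psi, if_pos (show _ ∧ _ from hu),
    if_pos ⟨hu.1, (hu.normV_le hc₀).trans (ENNReal.ofReal_le_ofReal hC)⟩, add_zero]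

theorem total_ne_bot : total c₀ C u ≠ ⊥ := EReal.coe_ennreal_ne_bot _

theorem total_lt_top_iff (hc₀ : 0 ≤ c₀) (hC : 2 * c₀ ≤ C) :
    total c₀ C u < ⊤ ↔ Admissible c₀ u ∧ ∫⁻ h, Phi (eta u h + c₀) < ⊤ := by
  by_cases hu : Admissible c₀ u
  · rw [hu.total_eq hc₀ hC, ← EReal.coe_ennreal_top, EReal.coe_ennreal_lt_coe_ennreal_iff]
    exact (and_iff_right hu).symm
  · have htop : total c₀ C u = ⊤ := by
      rw [total, phi, if_neg (show ¬ (_ ∧ _) from hu), top_add, EReal.coe_ennreal_top]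
    simp only [htop, lt_self_iff_false, hu, false_and]

theorem total_zero_lt_top (hc₀ : 0 < c₀) (hC : 2 * c₀ ≤ C) : total c₀ C 0 < ⊤ := by
  have hh_zero : hh 0 = 0 := by
    rw [IsPotential.zero.hasMeasureHH.hh_eq, withDensityᵥ_zero]
  have eta_zero : eta 0 =ᵐ[volume] 0 := by
    refine (SignedMeasure.eq_rnDeriv 0 0 (integrable_zero _ _ _)
      VectorMeasure.MutuallySingular.zero_left ?_).symm
    rw [hh_zero, withDensityᵥ_zero, add_zero]
  refine (total_lt_top_iff hc₀.le hC).2 ⟨⟨IsPotential.zero.mem_V, ?_⟩, ?_⟩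
  · rw [hh_zero, zero_add]
    exact smul_toSignedMeasure_nonneg hc₀.le
  · have hconst : ∀ᵐ h, Phi (eta 0 h + c₀) = ENNReal.ofReal ((c₀ ^ 2)⁻¹ / 2) := by
      filter_upwards [eta_zero] with h hη
      rw [hη, Pi.zero_apply, zero_add, Phi_of_pos hc₀]
    rw [lintegral_congr_ae hconst, lintegral_const, UnitAddCircle.measure_univ, mul_one]
    exact ENNReal.ofReal_lt_top

theorem total_lt_top_of_mem_B (hc₀ : 0 < c₀) (hC : 2 * c₀ ≤ C) (hξ : ξ ∈ B c₀ C u) :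
    total c₀ C u < ⊤ := by
  have hle := (hξ.2 0 IsPotential.zero.mem_V).trans_lt (total_zero_lt_top hc₀ hC)
  by_contra htop
  rw [not_lt_top_iff.1 htop, EReal.top_add_coe] at hle
  exact lt_irrefl _ hle

end Perturbation

section EulerLagrange

variable {c₀ C δ K : ℝ} {u v w ξ : U} {S R σ : 𝕋 → ℝ}

theorem total_add_smul_le (hc₀ : 0 ≤ c₀) (hC : 2 * c₀ ≤ C) (hu : Admissible c₀ u)
    (hfin : ∫⁻ h, Phi (eta u h + c₀) < ⊤) (hδ : 0 < δ) (hσ : Measurable σ)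
    (hK : ∀ h, |σ h| ≤ K) (hσ_supp : ∀ h, σ h ≠ 0 → δ ≤ eta u h + c₀) (hv : IsPotential v S σ)
    {ε : ℝ} (hε : ∀ h, |ε * σ h| ≤ δ / 2) :
    u + ε • v ∈ V ∧ total c₀ C (u + ε • v) ≤
      (((∫ h, ((eta u h + c₀) ^ 2)⁻¹ / 2) - ε * (∫ h, σ h * ((eta u h + c₀) ^ 3)⁻¹) +
        (∫ h, 8 * σ h ^ 2 / δ ^ 4) * ε ^ 2 : ℝ) : EReal) := by
  have hr : Measurable fun h => eta u h + c₀ := (measurable_eta u).add_const c₀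
  have hεv := hv.smul ε
  have hadm : Admissible c₀ (u + ε • v) := by
    refine hu.add_potential hεv ?_
    filter_upwards [ae_pos_of_lintegral_Phi_lt_top hr hfin] with h hpos
    rw [add_right_comm]
    exact (add_pos_and_inv_add_sq_le hδ hpos (fun hne => hσ_supp h (right_ne_zero_of_mul hne))
      (hε h)).1.le
  refine ⟨hadm.1, ?_⟩
  have heta : ∀ᵐ h, Phi (eta (u + ε • v) h + c₀) = Phi (eta u h + c₀ + ε * σ h) := by
    filter_upwards [eta_add_potential hu.1 hεv] with h hη
    rw [hη, Pi.add_apply, add_right_comm]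
  rw [hadm.total_eq hc₀ hC, lintegral_congr_ae heta]
  exact coe_lintegral_Phi_add_le hr hfin hσ hδ hK hσ_supp hε

theorem inner_add_integral_mul_inv_cube_eq_zero (hc₀ : 0 < c₀) (hC : 2 * c₀ ≤ C)
    (hξ : ξ ∈ B c₀ C u) (hδ : 0 < δ) (hσ : Measurable σ) (hK : ∀ h, |σ h| ≤ K)
    (hσ_supp : ∀ h, σ h ≠ 0 → δ ≤ eta u h + c₀) (hv : IsPotential v S σ) :
    ⟪ξ, v⟫_ℝ + ∫ h, σ h * ((eta u h + c₀) ^ 3)⁻¹ = 0 := by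
  obtain ⟨hu, hfin⟩ := (total_lt_top_iff hc₀.le hC).1 (total_lt_top_of_mem_B hc₀ hC hξ)
  have hsmall : ∀ᶠ ε in nhds (0 : ℝ), ∀ h, |ε * σ h| ≤ δ / 2 := by
    have htendsto : Filter.Tendsto (fun ε : ℝ => |ε| * K) (nhds 0) (nhds 0) := by
      simpa using (continuous_abs.mul continuous_const).tendsto (0 : ℝ) (f := fun ε => |ε| * K)
    filter_upwards [htendsto.eventually_le_const (half_pos hδ)] with ε hε h
    rw [abs_mul]
    exact (mul_le_mul_of_nonneg_left (hK h) (abs_nonneg ε)).trans hε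
  refine eq_zero_of_eventually_mul_le_sq (L := ∫ h, 8 * σ h ^ 2 / δ ^ 4) ?_
  filter_upwards [hsmall] with ε hε
  obtain ⟨hmem, hle⟩ := total_add_smul_le hc₀.le hC hu hfin hδ hσ hK hσ_supp hv hε
  have hsub := (hξ.2 _ hmem).trans hle
  rw [hu.total_eq hc₀.le hC, coe_lintegral_Phi_eq ((measurable_eta u).add_const c₀) hfin,
    add_sub_cancel_left, real_inner_smul_right (F := U) ξ v ε, ← EReal.coe_add,
    EReal.coe_le_coe_iff] at hsub
  linarith

theorem exists_ae_flux_add_eq_const_of_le (hc₀ : 0 < c₀) (hC : 2 * c₀ ≤ C) (hξ : ξ ∈ B c₀ C u)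
    (hw : IsPotential w R ξ.1) (hδ : 0 < δ) :
    ∃ m : ℝ, ∀ᵐ h, δ ≤ eta u h + c₀ → ((eta u h + c₀) ^ 3)⁻¹ + R h = m := by
  have hr : Measurable fun h => eta u h + c₀ := (measurable_eta u).add_const c₀
  have hR := hw.continuous
  obtain ⟨L, hL⟩ := isCompact_univ.exists_bound_of_continuousOn hR.continuousOn
  refine exists_ae_eq_const_of_forall_integral_mul_eq_zero (A := {h | δ ≤ eta u h + c₀})
    (P := fun h => ((eta u h + c₀) ^ 3)⁻¹ + R h) (K := (δ ^ 3)⁻¹ + L)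
    (measurableSet_le measurable_const hr) (by fun_prop) (fun h hδh => ?_)
    fun σ K hσ hK hσ_supp hσ_zero => ?_
  · have hpos : 0 < eta u h + c₀ := hδ.trans_le hδh
    refine (abs_add_le _ _).trans (add_le_add ?_ (hL h (mem_univ h)))
    rw [abs_of_pos (by positivity)]
    gcongr
    exact hδh
  · have hσ_int : Integrable σ := .of_bound hσ.aestronglyMeasurable K (.of_forall hK)
    obtain ⟨v, S, hv⟩ := exists_isPotential hσ_int hσ_zero
    have hinner : ⟪ξ, v⟫_ℝ = ∫ h, σ h * R h := by
      rw [real_inner_comm, inner_eq_integral, integral_mul_congr hv.ae_eq, hv.integral_mul hw]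
    have hvar := inner_add_integral_mul_inv_cube_eq_zero hc₀ hC hξ hδ hσ hK hσ_supp hv
    simp only [mul_add]
    rw [integral_add (integrable_mul_inv_cube hr hσ hδ hK hσ_supp)
      (integrable_mul_of_continuous hσ_int hR), add_comm, ← hinner, hvar]

theorem isFluxHH_neg_of_mem_B (hc₀ : 0 < c₀) (hC : 2 * c₀ ≤ C) (hξ : ξ ∈ B c₀ C u) :
    IsFluxHH c₀ u (-ξ) := by
  obtain ⟨hu, hfin⟩ := (total_lt_top_iff hc₀.le hC).1 (total_lt_top_of_mem_B hc₀ hC hξ)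
  have hpos := ae_pos_of_lintegral_Phi_lt_top ((measurable_eta u).add_const c₀) hfin
  obtain ⟨w, R, hw⟩ := exists_isPotential (integrable_coe ξ.1) ξ.2
  obtain ⟨m, hm⟩ := exists_ae_eq_const_of_forall_le hpos fun δ hδ =>
    exists_ae_flux_add_eq_const_of_le hc₀ hC hξ hw hδ
  exact ⟨hu.1, hpos, hw.hasL2HH_const_sub (hm.mono fun _ => eq_sub_of_add_eq)⟩

theorem IsFluxHH.unique {g k : U} (hg : IsFluxHH c₀ u g) (hk : IsFluxHH c₀ u k) : g = k :=
  hg.2.2.unique hk.2.2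

theorem IsFluxHH.energy_eq {g : U} (hg : IsFluxHH c₀ u g) :
    energy c₀ u = ENNReal.ofReal (1 / 2 * ‖g‖ ^ 2) := by
  have integral_sq (k : U) : ∫ h, k.1 h ^ 2 = ‖k‖ ^ 2 := by
    rw [← real_inner_self_eq_norm_sq, inner_eq_integral]
    simp only [sq]
  refine le_antisymm (iInf₂_le_of_le g hg (by rw [integral_sq])) (le_iInf₂ fun k hk => ?_)
  rw [hk.unique hg, integral_sq]

end EulerLagrange

section Evolution

variable {E : Type*} [NormedAddCommGroup E] [InnerProductSpace ℝ E]

theorem inner_sub_nonneg_of_subgradient {f : E → EReal} {u v ξ ζ : E} (hbot : f u ≠ ⊥)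
    (htop : f u ≠ ⊤) (hξ : f u + (⟪ξ, v - u⟫_ℝ : ℝ) ≤ f v)
    (hζ : f v + (⟪ζ, u - v⟫_ℝ : ℝ) ≤ f u) : 0 ≤ ⟪ξ - ζ, u - v⟫_ℝ := by
  lift f u to ℝ using ⟨htop, hbot⟩ with a
  have hv_bot : f v ≠ ⊥ := ne_bot_of_le_ne_bot (EReal.coe_ne_bot _) (EReal.coe_add _ _ ▸ hξ)
  have hv_top : f v ≠ ⊤ := by
    rintro hv
    rw [hv, EReal.top_add_coe] at hζ
    exact EReal.coe_ne_top _ (top_le_iff.1 hζ)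
  lift f v to ℝ using ⟨hv_top, hv_bot⟩ with b
  norm_cast at hξ hζ
  rw [← neg_sub u v, inner_neg_right] at hξ
  rw [inner_sub_left]
  linarith

/-- Monotonicity of a multivalued operator `A` on a real inner product space. -/
def IsMonotoneOperator (A : E → Set E) : Prop :=
  ∀ ⦃u v ξ ζ : E⦄, ξ ∈ A u → ζ ∈ A v → 0 ≤ ⟪ξ - ζ, u - v⟫_ℝ

/-- `w` solves `w' + A w ∋ 0` almost everywhere on `[0, T]`. That `w'` is the derivative of `w` is
expressed through the fundamental theorem of calculus. -/
structure IsFlow (A : E → Set E) (T : ℝ) (w w' : ℝ → E) : Prop where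
  integrableOn : IntegrableOn w' (Icc 0 T)
  eq_add_integral : ∀ t ∈ Icc 0 T, w t = w 0 + ∫ s in (0 : ℝ)..t, w' s
  neg_mem : ∀ᵐ t, t ∈ Icc 0 T → -w' t ∈ A (w t)

theorem absolutelyContinuousOnInterval_of_dist_le {X Y : Type*} [PseudoMetricSpace X]
    [PseudoMetricSpace Y] {f : ℝ → X} {g : ℝ → Y} {a b : ℝ}
    (hg : AbsolutelyContinuousOnInterval g a b)
    (h : ∀ x ∈ uIcc a b, ∀ y ∈ uIcc a b, dist (f x) (f y) ≤ dist (g x) (g y)) :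
    AbsolutelyContinuousOnInterval f a b := by
  rw [absolutelyContinuousOnInterval_iff] at hg ⊢
  refine fun ε hε => (hg ε hε).imp fun δ hδ => ⟨hδ.1, fun I hI hIδ => ?_⟩
  refine (Finset.sum_le_sum fun i hi => ?_).trans_lt (hδ.2 I hI hIδ)
  exact h _ (hI.1 i hi).1 _ (hI.1 i hi).2

theorem absolutelyContinuousOnInterval_norm_add_integral (x₀ : E) {f : ℝ → E} {a b : ℝ}
    (hf : IntervalIntegrable f volume a b) :
    AbsolutelyContinuousOnInterval (fun t => ‖x₀ + ∫ s in a..t, f s‖) a b := by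
  refine absolutelyContinuousOnInterval_of_dist_le
    (hf.norm.absolutelyContinuousOnInterval_intervalIntegral left_mem_uIcc) fun x hx y hy => ?_
  have hfi {z : ℝ} (hz : z ∈ uIcc a b) : IntervalIntegrable f volume a z :=
    hf.mono_set (uIcc_subset_uIcc left_mem_uIcc hz)
  calc dist ‖x₀ + ∫ s in a..x, f s‖ ‖x₀ + ∫ s in a..y, f s‖
      ≤ ‖(x₀ + ∫ s in a..x, f s) - (x₀ + ∫ s in a..y, f s)‖ := dist_norm_norm_le _ _
    _ = ‖∫ s in y..x, f s‖ := by
        rw [add_sub_add_left_eq_sub, intervalIntegral.integral_interval_sub_left (hfi hx) (hfi hy)]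
    _ ≤ |∫ s in y..x, ‖f s‖| := intervalIntegral.norm_integral_le_abs_integral_norm
    _ = dist (∫ s in a..x, ‖f s‖) (∫ s in a..y, ‖f s‖) := by
        rw [Real.dist_eq,
          intervalIntegral.integral_interval_sub_left (hfi hx).norm (hfi hy).norm]

theorem deriv_norm_le_of_inner_le {p : ℝ → E} {p' : E} {t M : ℝ} (hp : HasDerivAt p p' t)
    (hd : DifferentiableAt ℝ (fun s => ‖p s‖) t) (hM : 0 ≤ M) (h : ⟪p', p t⟫_ℝ ≤ M * ‖p t‖) :
    deriv (fun s => ‖p s‖) t ≤ M := by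
  by_cases hpt : p t = 0
  · have hmin : IsLocalMin (fun s => ‖p s‖) t := .of_forall fun s => by simp [hpt]
    rwa [hmin.deriv_eq_zero]
  · have hsq := (hd.hasDerivAt.pow 2).unique hp.norm_sq
    rw [real_inner_comm] at h
    simp only [Nat.cast_ofNat, Nat.add_one_sub_one, pow_one] at hsq
    refine le_of_mul_le_mul_left ?_ (norm_pos_iff.2 hpt)
    linarith

theorem norm_add_integral_le [CompleteSpace E] (x₀ : E) {f : ℝ → E} {T M : ℝ} (hT : 0 ≤ T)
    (hM : 0 ≤ M) (hf : IntervalIntegrable f volume 0 T)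
    (h : ∀ᵐ t, t ∈ Icc 0 T → ⟪f t, x₀ + ∫ s in (0 : ℝ)..t, f s⟫_ℝ ≤
      M * ‖x₀ + ∫ s in (0 : ℝ)..t, f s‖) :
    ‖x₀ + ∫ s in (0 : ℝ)..T, f s‖ ≤ ‖x₀‖ + M * T := by
  set p : ℝ → E := fun t => x₀ + ∫ s in (0 : ℝ)..t, f s with hp
  have hac : AbsolutelyContinuousOnInterval (fun t => ‖p t‖) 0 T :=
    absolutelyContinuousOnInterval_norm_add_integral x₀ hf
  have hderiv : ∀ᵐ t, t ∈ Icc 0 T → deriv (fun s => ‖p s‖) t ≤ M := by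
    filter_upwards [hac.ae_differentiableAt, hf.ae_hasDerivAt_integral, h] with t hdiff hint hle ht
    rw [uIcc_of_le hT] at hdiff hint
    exact deriv_norm_le_of_inner_le ((hint ht 0 (left_mem_Icc.2 hT)).const_add x₀) (hdiff ht) hM
      (hle ht)
  have hle : ∫ t in (0 : ℝ)..T, deriv (fun s => ‖p s‖) t ≤ ∫ _ in (0 : ℝ)..T, M :=
    intervalIntegral.integral_mono_ae_restrict hT hac.intervalIntegrable_deriv
      intervalIntegrable_const ((ae_restrict_iff' measurableSet_Icc).2 hderiv)
  rw [hac.integral_deriv_eq_sub, intervalIntegral.integral_const, smul_eq_mul] at hle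
  simp only [hp, intervalIntegral.integral_same, add_zero] at hle
  linarith

namespace IsFlow

variable {A : E → Set E} {T : ℝ} {w w' : ℝ → E}

theorem intervalIntegrable (hw : IsFlow A T w w') {a b : ℝ} (ha : a ∈ Icc 0 T)
    (hb : b ∈ Icc 0 T) : IntervalIntegrable w' volume a b :=
  (hw.integrableOn.mono_set (uIcc_subset_Icc ha hb)).intervalIntegrable

theorem sub_eq_integral (hw : IsFlow A T w w') {a b : ℝ} (ha : a ∈ Icc 0 T) (hb : b ∈ Icc 0 T) :
    w b - w a = ∫ s in a..b, w' s := by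
  have hzero : (0 : ℝ) ∈ Icc 0 T := ⟨le_rfl, ha.1.trans ha.2⟩
  rw [hw.eq_add_integral b hb, hw.eq_add_integral a ha, add_sub_add_left_eq_sub]
  exact intervalIntegral.integral_interval_sub_left (hw.intervalIntegrable hzero hb)
    (hw.intervalIntegrable hzero ha)

theorem translate (hw : IsFlow A T w w') {s : ℝ} (hs : s ∈ Icc 0 T) :
    IsFlow A (T - s) (fun t => w (t + s)) fun t => w' (t + s) where
  integrableOn := by
    have hint := (hw.intervalIntegrable hs (right_mem_Icc.2 (hs.1.trans hs.2))).comp_add_right s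
    rwa [sub_self, intervalIntegrable_iff_integrableOn_Icc_of_le (sub_nonneg.2 hs.2)] at hint
  eq_add_integral t ht := by
    rw [intervalIntegral.integral_comp_add_right, zero_add, ← hw.sub_eq_integral hs
      ⟨by linarith [hs.1, ht.1], by linarith [ht.2]⟩, add_sub_cancel]
  neg_mem := by
    filter_upwards [(measurePreserving_add_right volume s).quasiMeasurePreserving.ae hw.neg_mem]
      with t h ht
    exact h ⟨by linarith [hs.1, ht.1], by linarith [ht.2]⟩

theorem restrict (hw : IsFlow A T w w') {t : ℝ} (ht : t ≤ T) : IsFlow A t w w' where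
  integrableOn := hw.integrableOn.mono_set (Icc_subset_Icc_right ht)
  eq_add_integral s hs := hw.eq_add_integral s (Icc_subset_Icc_right ht hs)
  neg_mem := hw.neg_mem.mono fun _ h hs => h (Icc_subset_Icc_right ht hs)

variable [CompleteSpace E]

theorem norm_sub_le {v v' : ℝ → E} (hA : IsMonotoneOperator A) (hT : 0 ≤ T)
    (hv : IsFlow A T v v') (hw : IsFlow A T w w') : ‖v T - w T‖ ≤ ‖v 0 - w 0‖ := by
  have hzero : (0 : ℝ) ∈ Icc 0 T := left_mem_Icc.2 hT
  have hsub {t : ℝ} (ht : t ∈ Icc 0 T) :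
      v 0 - w 0 + ∫ s in (0 : ℝ)..t, (v' s - w' s) = v t - w t := by
    rw [intervalIntegral.integral_sub (hv.intervalIntegrable hzero ht)
      (hw.intervalIntegrable hzero ht), hv.eq_add_integral t ht, hw.eq_add_integral t ht]
    abel
  have hTT : T ∈ Icc 0 T := right_mem_Icc.2 hT
  have hle := norm_add_integral_le (v 0 - w 0) hT le_rfl
    ((hv.intervalIntegrable hzero hTT).sub (hw.intervalIntegrable hzero hTT)) ?_
  · rwa [hsub hTT, zero_mul, add_zero] at hle
  · filter_upwards [hv.neg_mem, hw.neg_mem] with t hvt hwt ht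
    have hmono := hA (hvt ht) (hwt ht)
    rw [← neg_sub', inner_neg_left] at hmono
    rw [hsub ht]
    linarith

theorem norm_sub_initial_le (hA : IsMonotoneOperator A) (hT : 0 ≤ T) (hw : IsFlow A T w w')
    {ξ : E} (hξ : ξ ∈ A (w 0)) : ‖w T - w 0‖ ≤ ‖ξ‖ * T := by
  have hzero : (0 : ℝ) ∈ Icc 0 T := left_mem_Icc.2 hT
  have hTT : T ∈ Icc 0 T := right_mem_Icc.2 hT
  have hle := norm_add_integral_le 0 hT (norm_nonneg ξ) (hw.intervalIntegrable hzero hTT) ?_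
  · rwa [zero_add, ← hw.sub_eq_integral hzero hTT, norm_zero, zero_add] at hle
  · filter_upwards [hw.neg_mem] with t hwt ht
    rw [zero_add, ← hw.sub_eq_integral hzero ht]
    have hmono := hA (hwt ht) hξ
    rw [inner_sub_left, inner_neg_left] at hmono
    have hcs := real_inner_le_norm (-ξ) (w t - w 0)
    rw [inner_neg_left, norm_neg] at hcs
    linarith

theorem norm_sub_le_mul (hA : IsMonotoneOperator A) (hw : IsFlow A T w w') {ξ : E}
    (hξ : ξ ∈ A (w 0)) {s t : ℝ} (hs : 0 ≤ s) (hst : s ≤ t) (ht : t ≤ T) :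
    ‖w t - w s‖ ≤ ‖ξ‖ * (t - s) := by
  have hτ : 0 ≤ t - s := sub_nonneg.2 hst
  have htr := (hw.restrict ht).translate (s := t - s) ⟨hτ, sub_le_self t hs⟩
  rw [sub_sub_cancel] at htr
  calc ‖w t - w s‖ = ‖w (s + (t - s)) - w s‖ := by rw [add_sub_cancel]
    _ ≤ ‖w (0 + (t - s)) - w 0‖ := norm_sub_le hA hs htr (hw.restrict (hst.trans ht))
    _ ≤ ‖ξ‖ * (t - s) := by
        rw [zero_add]
        exact (hw.restrict (by linarith)).norm_sub_initial_le hA hτ hξ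

theorem norm_deriv_le (hA : IsMonotoneOperator A) (hw : IsFlow A T w w') {ξ : E}
    (hξ : ξ ∈ A (w 0)) : ∀ᵐ t, t ∈ Icc 0 T → ‖w' t‖ ≤ ‖ξ‖ := by
  obtain hT | hT := lt_or_ge T 0
  · exact .of_forall fun t ht => absurd (ht.1.trans ht.2) hT.not_ge
  have hzero : (0 : ℝ) ∈ Icc 0 T := left_mem_Icc.2 hT
  have hint := hw.intervalIntegrable hzero (right_mem_Icc.2 hT)
  filter_upwards [hint.ae_hasDerivAt_integral, Measure.ae_ne volume (0 : ℝ),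
    Measure.ae_ne volume T] with t hderiv ht_zero ht_T ht
  rw [uIcc_of_le hT] at hderiv
  refine (hderiv ht 0 hzero).le_of_lip' (norm_nonneg ξ) ?_
  filter_upwards [Icc_mem_nhds (ht.1.lt_of_ne' ht_zero) (ht.2.lt_of_ne ht_T)] with s hs
  rw [← hw.sub_eq_integral hzero hs, ← hw.sub_eq_integral hzero ht, sub_sub_sub_cancel_right,
    Real.norm_eq_abs]
  obtain hts | hst := le_total t s
  · rw [abs_of_nonneg (sub_nonneg.2 hts)]
    exact hw.norm_sub_le_mul hA hξ ht.1 hts hs.2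
  · rw [abs_sub_comm, abs_of_nonneg (sub_nonneg.2 hst), norm_sub_rev]
    exact hw.norm_sub_le_mul hA hξ hs.1 hst ht.2

end IsFlow

end Evolution

section Solutions

variable {c₀ C T : ℝ}

theorem isMonotoneOperator_B (hc₀ : 0 < c₀) (hC : 2 * c₀ ≤ C) : IsMonotoneOperator (B c₀ C) :=
  fun u v _ _ hξ hζ => inner_sub_nonneg_of_subgradient total_ne_bot
    (total_lt_top_of_mem_B hc₀ hC hξ).ne (hξ.2 v hζ.1) (hζ.2 u hξ.1)

theorem ae_time_iff {P : ℝ → Prop} : (∀ᵐ t ∂time T, P t) ↔ ∀ᵐ t, t ∈ Icc 0 T → P t :=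
  ae_restrict_iff' measurableSet_Icc

theorem IsVISolution.isFlow {w wt : ℝ → U} (hw : IsVISolution c₀ C T w wt) :
    IsFlow (B c₀ C) T w wt where
  integrableOn := by
    have : IsFiniteMeasure (time T) := by
      unfold time
      infer_instance
    exact hw.deriv_memLp.integrable le_top
  eq_add_integral := hw.deriv_eq
  neg_mem := by
    obtain ⟨M, hM⟩ := hw.bounded
    rw [← ae_time_iff]
    filter_upwards [hM, hw.inequality] with t ht hineq
    refine ⟨ht.1, fun v hv => ?_⟩
    rw [inner_neg_left, EReal.coe_neg, ← sub_eq_add_neg]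
    exact EReal.sub_le_of_le_add' (hineq v hv)

theorem IsVISolution.ae_isFluxHH {w wt : ℝ → U} (hc₀ : 0 < c₀) (hC : 2 * c₀ ≤ C)
    (hw : IsVISolution c₀ C T w wt) : ∀ᵐ t ∂time T, IsFluxHH c₀ (w t) (wt t) := by
  rw [ae_time_iff]
  filter_upwards [hw.isFlow.neg_mem] with t hmem ht
  simpa only [neg_neg] using isFluxHH_neg_of_mem_B hc₀ hC (hmem ht)

end Solutions

end ThinFilm

theorem theorem3p1 (c₀ C T : ℝ) (hc₀ : 0 < c₀) (hC : 2 * c₀ ≤ C) (hT : 0 < T)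
    (w₀ : U) (hw₀ : w₀ ∈ domB c₀ C)
    (w wt : ℝ → U) (hw : IsVISolution c₀ C T w wt) (hinit : w 0 = w₀) :
    IsStrongSolution c₀ T w wt := by
  obtain ⟨ξ, hξ⟩ := hw₀
  rw [← hinit] at hξ
  have hflux₀ : IsFluxHH c₀ (w 0) (-ξ) := isFluxHH_neg_of_mem_B hc₀ hC hξ
  have hflux : ∀ᵐ t ∂time T, IsFluxHH c₀ (w t) (wt t) := hw.ae_isFluxHH hc₀ hC
  have hspeed : ∀ᵐ t ∂time T, ‖wt t‖ ≤ ‖ξ‖ :=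
    ae_time_iff.2 (hw.isFlow.norm_deriv_le (isMonotoneOperator_B hc₀ hC) hξ)
  refine ⟨hw.toIsRegular, ⟨wt, hflux, .of_forall fun p => rfl, hw.deriv_memLp⟩, ?_, ?_⟩
  · rw [hflux₀.energy_eq]
    exact ENNReal.ofReal_lt_top
  · filter_upwards [hflux, hspeed] with t hflux_t hle
    rw [hflux_t.energy_eq, hflux₀.energy_eq, norm_neg]
    gcongr
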